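/- Let $(B,\mathfrak m)$ be a (commutative) Noetherian local ring with residue field $k=B/\mathfrak m$, and let $B'=B[x]_{\mathfrak m[x]}$ be the localization of the polynomial ring $B[x]$ at the prime ideal $\mathfrak m[x]=\mathfrak m B[x]$. Then $\mathfrak m'=\mathfrak m B'$ is the maximal ideal of $B'$, and $$\mathcal S\mathrm{l}(B)=\mathcal S\mathrm{l}(B').$$ Here the Samuel slope $\mathcal S\mathrm{l}(B)\in\mathbb R_{\ge 0}\cup\{\infty\}$ of a Noetherian local ring $(B,\mathfrak m,k)$ is defined as follows. For $f\in B$ put $\nu_{\mathfrak m}(f)=\sup\{m\in\mathbb N\mid f\in\mathfrak m^m\}\in\mathbb N\cup\{\infty\}$ and $\bar\nu_{\mathfrak m}(f)=\lim_{n\to\infty}\nu_{\mathfrak m}(f^n)/n$ (this limit always exists). Let $\mathfrak m^{\ge 1}=\{b\mid\bar\nu_{\mathfrak m}(b)\ge 1\}$ and $\mathfrak m^{>1}=\{b\mid\bar\nu_{\mathfrak m}(b)>1\}$, which are ideals, let $\lambda_{\mathfrak m}:\mathfrak m/\mathfrak m^2\to\mathfrak m^{\ge 1}/\mathfrak m^{>1}$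 be the natural map, and let $t=\dim_k(\mathfrak m/\mathfrak m^2)-\dim B$. - If $B$ is regular, then $\mathcal S\mathrm{l}(B)=\infty$. - If $B$ is not regular and $\dim_k\ker\lambda_{\mathfrak m}=t$ (so $t>0$), then $$\mathcal S\mathrm{l}(B)=\sup_{\gamma_1,\dots,\gamma_t}\ \min\{\bar\nu_{\mathfrak m}(\gamma_1),\dots,\bar\nu_{\mathfrak m}(\gamma_t)\},$$ where the supremum is over all $\gamma_1,\dots,\gamma_t\in\mathfrak m$ whose classes in $\mathfrak m/\mathfrak m^2$ form a basis of $\ker\lambda_{\mathfrak m}$. - Otherwise $\mathcal S\mathrm{l}(B)=1$. -/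

import Mathlib

open Filter Topology
open scoped ENNReal NNReal

noncomputable section

namespace SamuelSlope

section Order

variable {A : Type*} [CommRing A]

/-- The order `ν_I(f) = sup {m ∈ ℕ | f ∈ I ^ m} ∈ ℕ ∪ {∞}`. -/
def idealOrder (I : Ideal A) (f : A) : ℕ∞ :=
  ⨆ (m : ℕ) (_ : f ∈ I ^ m), (m : ℕ∞)

/-- The asymptotic Samuel function `ν̄_I(f) = lim_{n → ∞} ν_I(f ^ n) / n`, with values in
`[0, ∞]`. The limit always exists, see `tendsto_asymptoticSamuel`. -/
def asymptoticSamuel (I : Ideal A) (f : A) : ℝ≥0∞ :=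
  limUnder atTop (fun n : ℕ ↦ (idealOrder I (f ^ n) : ℝ≥0∞) / (n : ℝ≥0∞))

theorem natCast_le_idealOrder_iff (I : Ideal A) (f : A) (k : ℕ) :
    (k : ℕ∞) ≤ idealOrder I f ↔ f ∈ I ^ k := by
  constructor
  · intro h
    by_contra hf
    have h1 : idealOrder I f + 1 ≤ k := by
      have h2 : idealOrder I f ≤ ((k - 1 : ℕ) : ℕ∞) := by
        refine iSup₂_le fun m hm ↦ ?_
        have : m < k := by
          by_contra hk
          exact hf (Ideal.pow_le_pow_right (not_lt.mp hk) hm)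
        exact_mod_cast Nat.le_sub_one_of_lt this
      have hk : k ≠ 0 := by
        rintro rfl
        simp at hf
      calc idealOrder I f + 1 ≤ ((k - 1 : ℕ) : ℕ∞) + 1 := by gcongr
        _ = k := by exact_mod_cast Nat.succ_pred_eq_of_ne_zero hk
    have h3 : (k : ℕ∞) + 1 ≤ k := le_trans (by gcongr) h1
    have h4 : k + 1 ≤ k := by exact_mod_cast h3
    omega
  · intro h
    exact le_iSup₂_of_le k h le_rfl

theorem idealOrder_add_le_mul (I : Ideal A) (f g : A) :
    idealOrder I f + idealOrder I g ≤ idealOrder I (f * g) := by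
  have key : ∀ i j : ℕ, (i : ℕ∞) ≤ idealOrder I f → (j : ℕ∞) ≤ idealOrder I g →
      ((i + j : ℕ) : ℕ∞) ≤ idealOrder I (f * g) := by
    intro i j hi hj
    rw [natCast_le_idealOrder_iff] at hi hj ⊢
    rw [pow_add]
    exact Ideal.mul_mem_mul hi hj
  refine ENat.forall_natCast_le_iff_le.mp fun n hn ↦ ?_
  rcases eq_or_ne (idealOrder I f) ⊤ with hf | hf
  · simpa using key n 0 (by simp [hf]) (by simp)
  rcases eq_or_ne (idealOrder I g) ⊤ with hg | hg
  · simpa using key 0 n (by simp) (by simp [hg])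
  lift idealOrder I f to ℕ using hf with i
  lift idealOrder I g to ℕ using hg with j
  exact hn.trans (by simpa using key i j le_rfl le_rfl)

theorem mul_idealOrder_le_pow (I : Ideal A) (f : A) (n : ℕ) :
    (n : ℕ∞) * idealOrder I f ≤ idealOrder I (f ^ n) := by
  induction n with
  | zero => simp
  | succ n ih =>
    calc ((n + 1 : ℕ) : ℕ∞) * idealOrder I f = n * idealOrder I f + idealOrder I f := by
          push_cast; ring
      _ ≤ idealOrder I (f ^ n) + idealOrder I f := by gcongr
      _ ≤ _ := by rw [pow_succ]; exact idealOrder_add_le_mul I _ _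

theorem idealOrder_le_mul_left (I : Ideal A) (c f : A) :
    idealOrder I f ≤ idealOrder I (c * f) :=
  le_trans le_add_self (idealOrder_add_le_mul I c f)

theorem tendsto_natDiv_div (m : ℕ) :
    Tendsto (fun n : ℕ ↦ ((n / m : ℕ) : ℝ≥0∞) / (n : ℝ≥0∞)) atTop (𝓝 ((m : ℝ≥0∞)⁻¹)) ∨ m = 0 := by
  rcases Nat.eq_zero_or_pos m with hm | hm
  · exact Or.inr hm
  left
  have h := (tendsto_nat_floor_mul_div_atTop (R := ℝ) (a := (m : ℝ)⁻¹) (by positivity)).comp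
    tendsto_natCast_atTop_atTop
  have h2 := ENNReal.tendsto_ofReal h
  rw [ENNReal.ofReal_inv_of_pos (by positivity), ENNReal.ofReal_natCast] at h2
  refine h2.congr' ?_
  filter_upwards [eventually_gt_atTop 0] with n hn
  have : ⌊(m : ℝ)⁻¹ * n⌋₊ = n / m := by
    rw [inv_mul_eq_div, Nat.floor_div_eq_div]
  simp only [Function.comp_apply, this]
  rw [ENNReal.ofReal_div_of_pos (by positivity), ENNReal.ofReal_natCast, ENNReal.ofReal_natCast]

/-- Fekete: the sequence `ν_I(f ^ n) / n` converges to its supremum. -/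
theorem tendsto_iSup_idealOrder (I : Ideal A) (f : A) :
    Tendsto (fun n : ℕ ↦ (idealOrder I (f ^ n) : ℝ≥0∞) / (n : ℝ≥0∞)) atTop
      (𝓝 (⨆ m : ℕ, (idealOrder I (f ^ (m + 1)) : ℝ≥0∞) / ((m + 1 : ℕ) : ℝ≥0∞))) := by
  set S := ⨆ m : ℕ, (idealOrder I (f ^ (m + 1)) : ℝ≥0∞) / ((m + 1 : ℕ) : ℝ≥0∞) with hS
  refine tendsto_of_le_liminf_of_limsup_le ?_ ?_
  · refine iSup_le fun m ↦ ?_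
    have h1 := (tendsto_natDiv_div (m + 1)).resolve_right (by omega)
    have h2 := ENNReal.Tendsto.mul_const (b := (idealOrder I (f ^ (m + 1)) : ℝ≥0∞)) h1
      (Or.inl (by simp))
    rw [ENNReal.div_eq_inv_mul, ← h2.liminf_eq]
    refine liminf_le_liminf (Eventually.of_forall fun n ↦ ?_)
    have h3 : ((n / (m + 1) : ℕ) : ℕ∞) * idealOrder I (f ^ (m + 1)) ≤ idealOrder I (f ^ n) := by
      refine (mul_idealOrder_le_pow I _ _).trans ?_
      rw [← pow_mul]
      conv_rhs => rw [← Nat.mod_add_div n (m + 1), pow_add]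
      exact idealOrder_le_mul_left I _ _
    have h4 : ((n / (m + 1) : ℕ) : ℝ≥0∞) * (idealOrder I (f ^ (m + 1)) : ℝ≥0∞) ≤
        (idealOrder I (f ^ n) : ℝ≥0∞) := by
      exact_mod_cast ENat.toENNReal_le.mpr h3
    rw [← ENNReal.mul_div_right_comm]
    gcongr
  · refine limsup_le_of_le (h := ?_)
    filter_upwards [eventually_gt_atTop 0] with n hn
    obtain ⟨m, rfl⟩ : ∃ m, n = m + 1 := ⟨n - 1, by omega⟩
    exact le_iSup (fun m : ℕ ↦ (idealOrder I (f ^ (m + 1)) : ℝ≥0∞) / ((m + 1 : ℕ) : ℝ≥0∞)) m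

/-- The limit that defines `ν̄_I(f)` exists. -/
theorem tendsto_asymptoticSamuel (I : Ideal A) (f : A) :
    Tendsto (fun n : ℕ ↦ (idealOrder I (f ^ n) : ℝ≥0∞) / (n : ℝ≥0∞)) atTop
      (𝓝 (asymptoticSamuel I f)) :=
  tendsto_nhds_limUnder ⟨_, tendsto_iSup_idealOrder I f⟩

theorem asymptoticSamuel_eq_iSup (I : Ideal A) (f : A) : asymptoticSamuel I f =
    ⨆ m : ℕ, (idealOrder I (f ^ (m + 1)) : ℝ≥0∞) / ((m + 1 : ℕ) : ℝ≥0∞) :=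
  (tendsto_iSup_idealOrder I f).limUnder_eq

theorem le_asymptoticSamuel (I : Ideal A) (f : A) {n : ℕ} (hn : n ≠ 0) :
    (idealOrder I (f ^ n) : ℝ≥0∞) / (n : ℝ≥0∞) ≤ asymptoticSamuel I f := by
  obtain ⟨m, rfl⟩ := Nat.exists_eq_succ_of_ne_zero hn
  rw [asymptoticSamuel_eq_iSup]
  exact le_iSup (fun m : ℕ ↦ (idealOrder I (f ^ (m + 1)) : ℝ≥0∞) / ((m + 1 : ℕ) : ℝ≥0∞)) m

theorem le_asymptoticSamuel_of_mem_pow {I : Ideal A} {f : A} {k : ℕ} (h : f ∈ I ^ k) :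
    (k : ℝ≥0∞) ≤ asymptoticSamuel I f := by
  have h1 := le_asymptoticSamuel I f one_ne_zero
  rw [pow_one, Nat.cast_one, div_one] at h1
  refine le_trans ?_ h1
  exact_mod_cast ENat.toENNReal_le.mpr ((natCast_le_idealOrder_iff I f k).mpr h)

theorem asymptoticSamuel_zero (I : Ideal A) : asymptoticSamuel I 0 = ⊤ :=
  ENNReal.eq_top_of_forall_nnreal_le fun r ↦ by
    obtain ⟨n, hn⟩ := exists_nat_ge r
    exact le_trans (by exact_mod_cast hn) (le_asymptoticSamuel_of_mem_pow (zero_mem (I ^ n)))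

theorem asymptoticSamuel_le_mul_left (I : Ideal A) (c f : A) :
    asymptoticSamuel I f ≤ asymptoticSamuel I (c * f) := by
  rw [asymptoticSamuel_eq_iSup, asymptoticSamuel_eq_iSup]
  refine iSup_mono fun m ↦ ?_
  rw [mul_pow]
  gcongr
  exact idealOrder_le_mul_left I _ _

theorem exists_pow_mem_of_lt {I : Ideal A} {f : A} {r : ℝ≥0} (h : r < asymptoticSamuel I f) :
    ∃ n : ℕ, n ≠ 0 ∧ ((⌈r * n⌉₊ : ℕ) : ℕ∞) ≤ idealOrder I (f ^ n) := by
  rw [asymptoticSamuel_eq_iSup, lt_iSup_iff] at h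
  obtain ⟨m, hm⟩ := h
  refine ⟨m + 1, by omega, ?_⟩
  rw [ENNReal.lt_div_iff_mul_lt (by simp) (by simp)] at hm
  rcases eq_or_ne (idealOrder I (f ^ (m + 1))) ⊤ with hf | hf
  · simp [hf]
  · lift idealOrder I (f ^ (m + 1)) to ℕ using hf with i
    have hm' : r * ((m + 1 : ℕ) : ℝ≥0) < i := by
      rw [← ENNReal.coe_lt_coe]
      simpa using hm
    exact_mod_cast Nat.ceil_le.mpr hm'.le

theorem min_le_asymptoticSamuel_add (I : Ideal A) (f g : A) :
    min (asymptoticSamuel I f) (asymptoticSamuel I g) ≤ asymptoticSamuel I (f + g) := by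
  refine ENNReal.le_of_forall_nnreal_lt fun r hr ↦ ?_
  obtain ⟨n, hn, hfn⟩ := exists_pow_mem_of_lt (lt_of_lt_of_le hr (min_le_left _ _))
  obtain ⟨m, hm, hgm⟩ := exists_pow_mem_of_lt (lt_of_lt_of_le hr (min_le_right _ _))
  rw [natCast_le_idealOrder_iff] at hfn hgm
  set N := n * m with hN
  have hN0 : N ≠ 0 := Nat.mul_ne_zero hn hm
  set s := ⌈r * N⌉₊ with hs
  have hf : f ^ N ∈ I ^ s := by
    have h1 : (f ^ n) ^ m ∈ (I ^ ⌈r * n⌉₊) ^ m := Ideal.pow_mem_pow hfn m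
    rw [← pow_mul, ← pow_mul] at h1
    refine Ideal.pow_le_pow_right (Nat.ceil_le.mpr ?_) h1
    push_cast [hN]
    rw [← mul_assoc]
    gcongr
    exact Nat.le_ceil _
  have hg : g ^ N ∈ I ^ s := by
    have h1 : (g ^ m) ^ n ∈ (I ^ ⌈r * m⌉₊) ^ n := Ideal.pow_mem_pow hgm n
    rw [← pow_mul, ← pow_mul, mul_comm m n] at h1
    refine Ideal.pow_le_pow_right (Nat.ceil_le.mpr ?_) h1
    push_cast [hN]
    rw [mul_comm (n : ℝ≥0), ← mul_assoc]
    gcongr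
    exact Nat.le_ceil _
  have hpow : ∀ (h : A) (i : ℕ), h ^ N ∈ I ^ s → h ^ i ∈ I ^ (s * (i / N)) := by
    intro h i hh
    have h1 : (h ^ N) ^ (i / N) ∈ (I ^ s) ^ (i / N) := Ideal.pow_mem_pow hh _
    rw [← pow_mul, ← pow_mul] at h1
    rw [← Nat.mod_add_div i N, pow_add]
    refine Ideal.mul_mem_left _ _ ?_
    simpa [Nat.add_mul_div_left _ _ (Nat.pos_of_ne_zero hN0),
      Nat.div_eq_of_lt (Nat.mod_lt i (Nat.pos_of_ne_zero hN0))] using h1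
  have key : ∀ q : ℕ, (f + g) ^ (N * (q + 1)) ∈ I ^ (s * q) := by
    intro q
    rw [add_pow]
    refine sum_mem fun i hi ↦ Ideal.mul_mem_right _ _ ?_
    have hi' : i ≤ N * (q + 1) := by simpa [Nat.lt_succ_iff] using hi
    have h1 := Ideal.mul_mem_mul (hpow f i hf) (hpow g (N * (q + 1) - i) hg)
    rw [← pow_add, ← mul_add] at h1
    refine Ideal.pow_le_pow_right (Nat.mul_le_mul_left s ?_) h1
    have e1 := Nat.lt_mul_div_succ i (Nat.pos_of_ne_zero hN0)
    have e2 := Nat.lt_mul_div_succ (N * (q + 1) - i) (Nat.pos_of_ne_zero hN0)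
    have e3 : N * (q + 1) < N * (i / N + (N * (q + 1) - i) / N + 2) := by
      calc N * (q + 1) = i + (N * (q + 1) - i) := by omega
        _ < N * (i / N + 1) + N * ((N * (q + 1) - i) / N + 1) := by omega
        _ = _ := by ring
    have e4 := Nat.lt_of_mul_lt_mul_left e3
    omega
  have hq : ∀ q : ℕ, (r : ℝ≥0∞) * ((q : ℝ≥0∞) / ((q + 1 : ℕ) : ℝ≥0∞)) ≤
      asymptoticSamuel I (f + g) := by
    intro q
    refine le_trans ?_ (le_asymptoticSamuel I (f + g)
      (n := N * (q + 1)) (Nat.mul_ne_zero hN0 (by omega)))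
    have h1 : ((s * q : ℕ) : ℝ≥0∞) ≤ (idealOrder I ((f + g) ^ (N * (q + 1))) : ℝ≥0∞) := by
      exact_mod_cast ENat.toENNReal_le.mpr ((natCast_le_idealOrder_iff I _ _).mpr (key q))
    have h2 : (r : ℝ≥0∞) * N ≤ s := by
      have : r * (N : ℝ≥0) ≤ s := Nat.le_ceil _
      exact_mod_cast this
    rw [ENNReal.le_div_iff_mul_le (Or.inl (by simp [hN0])) (Or.inl (ENNReal.natCast_ne_top _))]
    refine le_trans ?_ h1
    calc (r : ℝ≥0∞) * ((q : ℝ≥0∞) / ((q + 1 : ℕ) : ℝ≥0∞)) * ((N * (q + 1) : ℕ) : ℝ≥0∞)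
        = r * N * ((q : ℝ≥0∞) / ((q + 1 : ℕ) : ℝ≥0∞) * ((q + 1 : ℕ) : ℝ≥0∞)) := by
          push_cast; ring
      _ = r * N * q := by rw [ENNReal.div_mul_cancel (by simp) (by simp)]
      _ ≤ s * q := by gcongr
      _ = ((s * q : ℕ) : ℝ≥0∞) := by push_cast; ring
  have hlim : Tendsto (fun q : ℕ ↦ (q : ℝ≥0∞) / ((q + 1 : ℕ) : ℝ≥0∞)) atTop (𝓝 1) := by
    have h := ENNReal.tendsto_ofReal (tendsto_natCast_div_add_atTop (1 : ℝ))
    rw [ENNReal.ofReal_one] at h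
    refine h.congr fun q ↦ ?_
    rw [ENNReal.ofReal_div_of_pos (by positivity), ENNReal.ofReal_natCast]
    congr 1
    exact_mod_cast ENNReal.ofReal_natCast (q + 1)
  have hlim2 := ENNReal.Tendsto.const_mul (a := (r : ℝ≥0∞)) hlim (Or.inl one_ne_zero)
  rw [mul_one] at hlim2
  exact le_of_tendsto' hlim2 hq

/-- The ideal `I^{≥ r} = {b | ν̄_I(b) ≥ r}`. -/
def samuelGE (I : Ideal A) (r : ℝ≥0) : Ideal A where
  carrier := {b | (r : ℝ≥0∞) ≤ asymptoticSamuel I b}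
  zero_mem' := by simp [asymptoticSamuel_zero]
  add_mem' {a b} ha hb := (le_min ha hb).trans (min_le_asymptoticSamuel_add I a b)
  smul_mem' c b hb := le_trans hb (asymptoticSamuel_le_mul_left I c b)

/-- The ideal `I^{> r} = {b | ν̄_I(b) > r}`. -/
def samuelGT (I : Ideal A) (r : ℝ≥0) : Ideal A where
  carrier := {b | (r : ℝ≥0∞) < asymptoticSamuel I b}
  zero_mem' := by simp [asymptoticSamuel_zero]
  add_mem' {a b} ha hb := (lt_min ha hb).trans_le (min_le_asymptoticSamuel_add I a b)
  smul_mem' c b hb := lt_of_lt_of_le hb (asymptoticSamuel_le_mul_left I c b)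

theorem le_samuelGE_one (I : Ideal A) : I ≤ samuelGE I 1 := fun b hb ↦ by
  have := le_asymptoticSamuel_of_mem_pow (k := 1) (I := I) (f := b) (by simpa using hb)
  simpa [samuelGE] using this

theorem pow_two_le_samuelGT_one (I : Ideal A) : I ^ 2 ≤ samuelGT I 1 := fun b hb ↦ by
  have := le_asymptoticSamuel_of_mem_pow hb
  refine lt_of_lt_of_le ?_ this
  norm_num

/-- The natural map `λ_I : I / I ^ 2 → I^{≥ 1} / I^{> 1}` sending the class of `b ∈ I` to the
class of `b`. -/
def lambdaMap (I : Ideal A) :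
    I.Cotangent →ₗ[A] (samuelGE I 1 ⧸ (samuelGT I 1).submoduleOf (samuelGE I 1)) :=
  Submodule.mapQ (I • ⊤ : Submodule A I) ((samuelGT I 1).submoduleOf (samuelGE I 1))
    (Submodule.inclusion (le_samuelGE_one I)) (by
      intro b hb
      have h : (b : A) ∈ I ^ 2 :=
        (I.toCotangent_eq_zero b).mp ((Submodule.Quotient.mk_eq_zero _).mpr hb)
      exact pow_two_le_samuelGT_one I h)

theorem lambdaMap_toCotangent (I : Ideal A) (b : I) :
    lambdaMap I (I.toCotangent b) =
      Submodule.Quotient.mk (Submodule.inclusion (le_samuelGE_one I) b) :=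
  rfl

theorem lambdaMap_toCotangent_eq_zero_iff (I : Ideal A) (b : I) :
    lambdaMap I (I.toCotangent b) = 0 ↔ 1 < asymptoticSamuel I (b : A) := by
  rw [lambdaMap_toCotangent, Submodule.Quotient.mk_eq_zero]
  rfl

end Order

section Slope

open IsLocalRing

variable (B : Type*) [CommRing B] [IsLocalRing B]

/-- The kernel of `λ_𝔪 : 𝔪 / 𝔪 ^ 2 → 𝔪^{≥ 1} / 𝔪^{> 1}`, as a subspace of the
`B / 𝔪`-vector space `𝔪 / 𝔪 ^ 2`. -/
def lambdaKer : Submodule (ResidueField B) (CotangentSpace B) where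
  carrier := {v | lambdaMap (maximalIdeal B) v = 0}
  zero_mem' := map_zero _
  add_mem' {v w} hv hw := by
    simp only [Set.mem_ofPred_eq] at hv hw ⊢
    rw [map_add, hv, hw, add_zero]
  smul_mem' c v hv := by
    obtain ⟨b, rfl⟩ := residue_surjective c
    simp only [Set.mem_ofPred_eq] at hv ⊢
    have h : residue B b • v = b • v := algebraMap_smul (ResidueField B) b v
    rw [h, map_smul, hv, smul_zero]

/-- The excess of embedding dimension `dim_k (𝔪 / 𝔪 ^ 2) - dim B`. For Noetherian `B` the
subtraction does not truncate, see `excEmbDim_add_ringKrullDim`. -/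
def excEmbDim : ℕ :=
  Module.finrank (ResidueField B) (CotangentSpace B) - ((ringKrullDim B).unbotD 0).toNat

theorem excEmbDim_add_ringKrullDim [IsNoetherianRing B] :
    (excEmbDim B : WithBot ℕ∞) + ringKrullDim B =
      Module.finrank (ResidueField B) (CotangentSpace B) := by
  have h := ringKrullDim_le_spanFinrank_maximalIdeal B
  rw [spanFinrank_maximalIdeal_eq_finrank_cotangentSpace] at h
  obtain ⟨d, hd⟩ : ∃ d : ℕ, ringKrullDim B = d := by
    obtain ⟨e, he⟩ := WithBot.ne_bot_iff_exists.mp (ringKrullDim_ne_bot (R := B))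
    rw [← he] at h ⊢
    have h' : e ≤ (Module.finrank (ResidueField B) (CotangentSpace B) : ℕ∞) := by
      exact_mod_cast h
    obtain ⟨d, rfl⟩ := ENat.ne_top_iff_exists.mp (ne_top_of_le_ne_top (ENat.natCast_ne_top _) h')
    exact ⟨d, rfl⟩
  have hdle : d ≤ Module.finrank (ResidueField B) (CotangentSpace B) := by
    rw [hd] at h
    exact_mod_cast h
  have hu : ((ringKrullDim B).unbotD 0).toNat = d := by
    rw [hd]
    rfl
  rw [excEmbDim, hu, hd]
  exact_mod_cast Nat.sub_add_cancel hdle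

/-- `B` is in the extremal case: `dim_k ker λ_𝔪` equals the excess of embedding dimension, and
this number is positive. -/
def IsExtremal : Prop :=
  Module.finrank (ResidueField B) (lambdaKer B) = excEmbDim B ∧ 0 < excEmbDim B

variable {B} in
/-- A `λ_𝔪`-sequence: elements of `𝔪` whose classes in `𝔪 / 𝔪 ^ 2` form a basis of
`ker λ_𝔪`. -/
def IsLambdaSequence {t : ℕ} (γ : Fin t → maximalIdeal B) : Prop :=
  LinearIndependent (ResidueField B) (fun i ↦ (maximalIdeal B).toCotangent (γ i)) ∧
    Submodule.span (ResidueField B) (Set.range fun i ↦ (maximalIdeal B).toCotangent (γ i)) =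
      lambdaKer B

open Classical in
/-- The Samuel slope of a Noetherian local ring `B`, in `[0, ∞]`: it is `∞` if `B` is regular,
`1` if `B` is neither regular nor in the extremal case, and in the extremal case it is the
supremum over all `λ_𝔪`-sequences `γ_1, …, γ_t`, where `t` is the excess of embedding dimension,
of `min {ν̄_𝔪(γ_1), …, ν̄_𝔪(γ_t)}`. -/
def samuelSlope : ℝ≥0∞ :=
  if IsRegularLocalRing B then ⊤
  else if IsExtremal B then
    ⨆ (γ : Fin (excEmbDim B) → maximalIdeal B) (_ : IsLambdaSequence γ),
      ⨅ i, asymptoticSamuel (maximalIdeal B) (γ i : B)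
  else 1

/-- The ring `B[x]` localized at the prime ideal `𝔪[x] = 𝔪 B[x]`. -/
abbrev PolynomialLocalization : Type _ :=
  Localization.AtPrime ((maximalIdeal B).map (Polynomial.C : B →+* Polynomial B))

end Slope

end SamuelSlope

end

open IsLocalRing Polynomial

namespace SamuelSlope

/-! ### Preliminaries valid in any ring or local ring. -/

section General

variable {A : Type*} [CommRing A]

/-! A polynomial lies in `𝔪' ^ k` exactly when all its coefficients lie in `𝔪 ^ k`
(`algebraMap_mem_pow_iff`). Hence `ν̄` is unchanged on elements of `B`, and `ν̄_{𝔪'}(f) ≤ ν̄_𝔪(a)`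
for every coefficient `a` of a polynomial `f` (`asymptoticSamuel_algebraMap_le_coeff`). Every
element of `B'` is a polynomial up to a unit, and units do not affect `ν̄`.

Consequently `𝔪' / 𝔪' ^ 2` and `ker λ_{𝔪'}` are the `k'`-spans of the images of `𝔪 / 𝔪 ^ 2` and `ker
λ_𝔪`, where `k'` is the residue field of `B'`. Independence survives the extension, so these spaces
keep their dimensions. As `dim B' = dim B`, both rings fall in the same case of the definition of
the slope.

In the extremal case a `λ`-sequence of `B` is one of `B'` with the same values. Conversely, the
coefficients of the numerators of a `λ`-sequence of `B'` span `ker λ_𝔪` and have `ν̄` at least the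
minimum of that sequence, so a basis chosen among them does at least as well. -/

theorem asymptoticSamuel_mul_of_isUnit (I : Ideal A) {u : A} (hu : IsUnit u) (f : A) :
    asymptoticSamuel I (u * f) = asymptoticSamuel I f := by
  refine le_antisymm ?_ (asymptoticSamuel_le_mul_left I u f)
  obtain ⟨u, rfl⟩ := hu
  simpa using asymptoticSamuel_le_mul_left I (↑u⁻¹ : A) (u * f)

theorem idealOrder_le_of_forall {C : Type*} [CommRing C] {I : Ideal A} {J : Ideal C} {a : A}
    {c : C} (h : ∀ k, a ∈ I ^ k → c ∈ J ^ k) : idealOrder I a ≤ idealOrder J c := by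
  refine ENat.forall_natCast_le_iff_le.mp fun k hk ↦ ?_
  rw [natCast_le_idealOrder_iff] at hk ⊢
  exact h k hk

theorem asymptoticSamuel_le_of_forall {C : Type*} [CommRing C] {I : Ideal A} {J : Ideal C} {a : A}
    {c : C} (h : ∀ n k, a ^ n ∈ I ^ k → c ^ n ∈ J ^ k) :
    asymptoticSamuel I a ≤ asymptoticSamuel J c := by
  rw [asymptoticSamuel_eq_iSup, asymptoticSamuel_eq_iSup]
  refine iSup_mono fun m ↦ ?_
  gcongr
  exact idealOrder_le_of_forall (h _)

variable [IsLocalRing A]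

/-- Lifting the scalars to `A` puts independence in a form where denominators can be cleared and
coefficients compared. -/
theorem linearIndependent_toCotangent_iff {ι : Type*} [Fintype ι] (w : ι → maximalIdeal A) :
    LinearIndependent (ResidueField A) (fun i ↦ (maximalIdeal A).toCotangent (w i)) ↔
      ∀ c : ι → A, ∑ i, c i * (w i : A) ∈ maximalIdeal A ^ 2 → ∀ i, c i ∈ maximalIdeal A := by
  have key : ∀ c : ι → A, ∑ i, residue A (c i) •
      ((maximalIdeal A).toCotangent (w i) : CotangentSpace A) = 0 ↔
      ∑ i, c i * (w i : A) ∈ maximalIdeal A ^ 2 := by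
    intro c
    have h : ∑ i, residue A (c i) • ((maximalIdeal A).toCotangent (w i) : CotangentSpace A) =
        (maximalIdeal A).toCotangent (∑ i, c i • w i) := by
      rw [map_sum]
      refine Finset.sum_congr rfl fun i _ ↦ ?_
      rw [map_smul]
      exact algebraMap_smul (ResidueField A) (c i)
        ((maximalIdeal A).toCotangent (w i) : CotangentSpace A)
    rw [h]
    refine ((maximalIdeal A).toCotangent_eq_zero _).trans ?_
    simp
  refine Fintype.linearIndependent_iff.trans ⟨fun h c hc i ↦ ?_, fun h g hg i ↦ ?_⟩
  · exact (residue_eq_zero_iff _).mp (h (fun i ↦ residue A (c i)) ((key c).mpr hc) i)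
  · choose c hc using fun i ↦ residue_surjective (g i)
    obtain rfl : (fun i ↦ residue A (c i)) = g := funext hc
    exact (residue_eq_zero_iff _).mpr (h c ((key c).mp hg) i)

theorem toCotangent_mem_lambdaKer_iff (b : maximalIdeal A) :
    (maximalIdeal A).toCotangent b ∈ lambdaKer A ↔
      1 < asymptoticSamuel (maximalIdeal A) (b : A) :=
  lambdaMap_toCotangent_eq_zero_iff (maximalIdeal A) b

theorem isRegularLocalRing_iff_excEmbDim_eq_zero [IsNoetherianRing A] :
    IsRegularLocalRing A ↔ excEmbDim A = 0 := by
  rw [IsRegularLocalRing.iff_finrank_cotangentSpace, ← excEmbDim_add_ringKrullDim]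
  obtain ⟨d, hd⟩ := WithBot.ne_bot_iff_exists.mp (ringKrullDim_ne_bot (R := A))
  -- Finiteness of the dimension is what allows it to be cancelled.
  have hdt : d ≠ ⊤ := by
    rintro rfl
    exact ringKrullDim_ne_top hd.symm
  lift d to ℕ using hdt
  rw [← hd]
  norm_cast
  omega

end General

/-! ### Powers of the maximal ideal of `B'`, read off from coefficients. -/

section Polynomial

variable {B : Type*} [CommRing B] [IsLocalRing B]

/-- Some coefficient of `s` is a unit. By McCoy's theorem, a zero divisor in `(B ⧸ J)[X]` is killed
by a nonzero constant, which would have to kill that unit; so `s` is regular modulo `J`. The ideal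
`J` need not be prime, as the powers of `𝔪` require. -/
theorem mem_map_C_of_mul_mem {J : Ideal B} {s f : B[X]} (hs : s ∉ (maximalIdeal B).map C)
    (h : s * f ∈ J.map C) : f ∈ J.map C := by
  rw [Ideal.mem_map_C_iff] at hs
  push Not at hs
  obtain ⟨n, hn⟩ := hs
  have hu : IsUnit (s.coeff n) := by simpa using hn
  have hreg : s.map (Ideal.Quotient.mk J) ∈ nonZeroDivisors (B ⧸ J)[X] := by
    by_contra hcon
    obtain ⟨a, ha, h0⟩ := Polynomial.notMem_nonZeroDivisors_iff.mp hcon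
    have h1 := congrArg (fun p ↦ p.coeff n) h0
    simp only [coeff_smul, coeff_map, smul_eq_mul, coeff_zero] at h1
    exact ha (((hu.map (Ideal.Quotient.mk J)).mul_left_eq_zero).mp h1)
  have hmap : ∀ g : B[X], g ∈ J.map C ↔ g.map (Ideal.Quotient.mk J) = 0 := fun g ↦ by
    simp [Ideal.mem_map_C_iff, Polynomial.ext_iff, Ideal.Quotient.eq_zero_iff_mem]
  rw [hmap] at h ⊢
  rw [Polynomial.map_mul] at h
  exact hreg.1 _ h

local notation "B'" => PolynomialLocalization B

theorem maximalIdeal_polynomialLocalization :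
    maximalIdeal B' = (maximalIdeal B).map (algebraMap B B') := by
  rw [IsScalarTower.algebraMap_eq B B[X] B', ← Ideal.map_map]
  exact (Localization.AtPrime.map_eq_maximalIdeal).symm

theorem algebraMap_mem_map_iff (J : Ideal B) (f : B[X]) :
    algebraMap B[X] B' f ∈ J.map (algebraMap B B') ↔ ∀ i, f.coeff i ∈ J := by
  rw [← Ideal.mem_map_C_iff, IsScalarTower.algebraMap_eq B B[X] B', ← Ideal.map_map,
    IsLocalization.algebraMap_mem_map_algebraMap_iff
      ((maximalIdeal B).map (C : B →+* B[X])).primeCompl]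
  refine ⟨fun ⟨s, hs, h⟩ ↦ mem_map_C_of_mul_mem hs h, fun h ↦ ⟨1, one_mem _, ?_⟩⟩
  simpa using h

theorem algebraMap_mem_pow_iff (k : ℕ) (f : B[X]) :
    algebraMap B[X] B' f ∈ maximalIdeal B' ^ k ↔ ∀ i, f.coeff i ∈ maximalIdeal B ^ k := by
  rw [maximalIdeal_polynomialLocalization, ← Ideal.map_pow, algebraMap_mem_map_iff]

theorem algebraMap_mem_maximalIdeal_iff (f : B[X]) :
    algebraMap B[X] B' f ∈ maximalIdeal B' ↔ ∀ i, f.coeff i ∈ maximalIdeal B := by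
  simpa using algebraMap_mem_pow_iff 1 f

theorem algebraMap_C (b : B) : algebraMap B[X] B' (C b) = algebraMap B B' b :=
  (IsScalarTower.algebraMap_apply B B[X] B' b).symm

theorem algebraMap_base_mem_pow_iff (k : ℕ) (b : B) :
    algebraMap B B' b ∈ maximalIdeal B' ^ k ↔ b ∈ maximalIdeal B ^ k := by
  rw [← algebraMap_C, algebraMap_mem_pow_iff]
  refine ⟨fun h ↦ by simpa using h 0, fun h i ↦ ?_⟩
  rw [coeff_C]
  split_ifs
  · exact h
  · exact zero_mem _

theorem asymptoticSamuel_algebraMap_base (b : B) :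
    asymptoticSamuel (maximalIdeal B') (algebraMap B B' b) =
      asymptoticSamuel (maximalIdeal B) b :=
  le_antisymm
    (asymptoticSamuel_le_of_forall fun n k h ↦ by
      rwa [← map_pow, algebraMap_base_mem_pow_iff] at h)
    (asymptoticSamuel_le_of_forall fun n k h ↦ by
      rwa [← map_pow, algebraMap_base_mem_pow_iff])

/-! ### The asymptotic Samuel function of a polynomial and of its coefficients. -/

theorem asymptoticSamuel_algebraMap_le_leadingCoeff (f : B[X]) :
    asymptoticSamuel (maximalIdeal B') (algebraMap B[X] B' f) ≤
      asymptoticSamuel (maximalIdeal B) f.leadingCoeff := by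
  refine asymptoticSamuel_le_of_forall fun n k h ↦ ?_
  rw [← map_pow, algebraMap_mem_pow_iff] at h
  have := h (n * f.natDegree)
  rwa [coeff_pow_mul_natDegree] at this

/-- Only the leading coefficient of `f ^ n` is a pure power of a coefficient of `f` in general, so
the leading terms are peeled off one at a time. The leading term has `ν̄` at least that of its
coefficient, hence at least `ν̄(f)`; subtracting it cannot lower `ν̄` below `ν̄(f)`, and induction
on the number of terms applies. -/
theorem asymptoticSamuel_algebraMap_le_coeff (f : B[X]) (i : ℕ) :
    asymptoticSamuel (maximalIdeal B') (algebraMap B[X] B' f) ≤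
      asymptoticSamuel (maximalIdeal B) (f.coeff i) := by
  induction hn : f.support.card using Nat.strong_induction_on generalizing f with
  | _ n ih =>
  rcases eq_or_ne f 0 with rfl | hf
  · simp [asymptoticSamuel_zero]
  have hl := asymptoticSamuel_algebraMap_le_leadingCoeff f
  rcases eq_or_ne i f.natDegree with rfl | hi
  · exact hl
  have herase : algebraMap B[X] B' f.eraseLead = algebraMap B[X] B' f +
      algebraMap B[X] B' (-X ^ f.natDegree) * algebraMap B B' f.leadingCoeff := by
    rw [← algebraMap_C, ← map_mul, ← map_add, ← self_sub_C_mul_X_pow]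
    congr 1
    ring
  have hle : asymptoticSamuel (maximalIdeal B') (algebraMap B[X] B' f) ≤
      asymptoticSamuel (maximalIdeal B') (algebraMap B[X] B' f.eraseLead) := by
    rw [herase]
    refine le_trans (le_min le_rfl ?_) (min_le_asymptoticSamuel_add _ _ _)
    refine le_trans ?_ (asymptoticSamuel_le_mul_left _ _ _)
    rwa [asymptoticSamuel_algebraMap_base]
  rw [← eraseLead_coeff_of_ne i hi]
  exact hle.trans (ih _ (hn ▸ eraseLead_support_card_lt hf) _ rfl)

theorem exists_isUnit_mul_eq_algebraMap (y : B') :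
    ∃ (u : B') (f : B[X]), IsUnit u ∧ u * y = algebraMap B[X] B' f := by
  obtain ⟨⟨f, s⟩, h⟩ := IsLocalization.surj
    ((maximalIdeal B).map (C : B →+* B[X])).primeCompl y
  exact ⟨_, f, IsLocalization.map_units B' s, by rw [mul_comm]; exact h⟩

/-! ### Extension of the cotangent space and of `ker λ`. -/

variable (B) in
/-- The natural map `𝔪 / 𝔪 ^ 2 → 𝔪' / 𝔪' ^ 2`. -/
noncomputable def cotangentMap : CotangentSpace B →ₗ[B] CotangentSpace B' :=
  Ideal.mapCotangent (maximalIdeal B) (maximalIdeal B') (Algebra.ofId B B') fun b hb ↦ by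
    simpa [Algebra.ofId_apply] using (algebraMap_base_mem_pow_iff 1 b).mpr (by simpa using hb)

theorem algebraMap_base_mem (b : maximalIdeal B) :
    algebraMap B B' (b : B) ∈ maximalIdeal B' := by
  simpa using (algebraMap_base_mem_pow_iff 1 (b : B)).mpr (by simp)

theorem cotangentMap_toCotangent (b : maximalIdeal B) :
    cotangentMap B ((maximalIdeal B).toCotangent b) =
      (maximalIdeal B').toCotangent ⟨algebraMap B B' b, algebraMap_base_mem b⟩ :=
  rfl

theorem smul_mem_of_mem {A : Type*} [CommRing A] [IsLocalRing A]
    (N : Submodule (ResidueField A) (CotangentSpace A)) (a : A) {v : CotangentSpace A}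
    (hv : v ∈ N) : a • v ∈ N := by
  rw [← algebraMap_smul (ResidueField A) a v]
  exact N.smul_mem _ hv

/-- The map is only declared `B`-linear, so scalars of the residue field are lifted to `B` and then
sent to `B'`. -/
theorem cotangentMap_mem_span {U : Set (CotangentSpace B)} {v : CotangentSpace B}
    (hv : v ∈ Submodule.span (ResidueField B) U) :
    cotangentMap B v ∈ Submodule.span (ResidueField B') (cotangentMap B '' U) := by
  induction hv using Submodule.span_induction with
  | mem v hv => exact Submodule.subset_span ⟨v, hv, rfl⟩
  | zero => simp
  | add v w _ _ hv hw => rw [map_add]; exact add_mem hv hw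
  | smul c v _ hv =>
    obtain ⟨b, rfl⟩ := residue_surjective c
    have h : residue B b • v = b • v := algebraMap_smul (ResidueField B) b v
    rw [h, map_smul, ← algebraMap_smul B' b]
    exact smul_mem_of_mem _ _ hv

theorem span_cotangentMap_image_span (U : Set (CotangentSpace B)) :
    Submodule.span (ResidueField B') (cotangentMap B '' (Submodule.span (ResidueField B) U)) =
      Submodule.span (ResidueField B') (cotangentMap B '' U) := by
  refine le_antisymm (Submodule.span_le.mpr ?_)
    (Submodule.span_mono (Set.image_mono Submodule.subset_span))
  rintro _ ⟨v, hv, rfl⟩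
  exact cotangentMap_mem_span hv

/-- The class of a polynomial with coefficients in `𝔪`, divided by a unit, lies in every subspace
which contains the classes of its coefficients. -/
theorem toCotangent_mem_of_coeff_mem (N : Submodule (ResidueField B') (CotangentSpace B'))
    (y : maximalIdeal B') {u : B'} (hu : IsUnit u) {f : B[X]} (hf : u * y = algebraMap B[X] B' f)
    (h : ∀ (i : ℕ) (b : maximalIdeal B), (b : B) = f.coeff i →
      cotangentMap B ((maximalIdeal B).toCotangent b) ∈ N) :
    (maximalIdeal B').toCotangent y ∈ N := by
  have hfm : ∀ i, f.coeff i ∈ maximalIdeal B := by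
    rw [← algebraMap_mem_maximalIdeal_iff, ← hf]
    exact Ideal.mul_mem_left _ _ y.2
  have hsum : u • y = ∑ i ∈ f.support, algebraMap B[X] B' (X ^ i) •
      (⟨algebraMap B B' (f.coeff i), algebraMap_base_mem ⟨_, hfm i⟩⟩ : maximalIdeal B') := by
    apply Subtype.ext
    simp only [Submodule.coe_smul, smul_eq_mul, hf, AddSubmonoidClass.coe_finsetSum]
    conv_lhs => rw [f.as_sum_support_C_mul_X_pow, map_sum]
    refine Finset.sum_congr rfl fun i _ ↦ ?_
    rw [map_mul, algebraMap_C, mul_comm]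
  have hmem : u • ((maximalIdeal B').toCotangent y : CotangentSpace B') ∈ N := by
    have e : u • ((maximalIdeal B').toCotangent y : CotangentSpace B') =
      (maximalIdeal B').toCotangent (u • y) := (map_smul _ _ _).symm
    rw [e, hsum, map_sum]
    refine sum_mem fun i _ ↦ ?_
    rw [map_smul]
    exact smul_mem_of_mem N _ (h i ⟨_, hfm i⟩ rfl)
  obtain ⟨u, rfl⟩ := hu
  have := smul_mem_of_mem N (↑u⁻¹ : B') hmem
  rwa [smul_smul, Units.inv_mul, one_smul] at this

/-- After a common denominator is cleared, a relation modulo `𝔪' ^ 2` has polynomial coefficients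
and splits, degree by degree, into relations modulo `𝔪 ^ 2` over `B`. -/
theorem linearIndependent_cotangentMap {ι : Type*} [Fintype ι] {v : ι → CotangentSpace B}
    (hv : LinearIndependent (ResidueField B) v) :
    LinearIndependent (ResidueField B') (fun i ↦ cotangentMap B (v i)) := by
  choose w hw using fun i ↦ (maximalIdeal B).toCotangent_surjective (v i)
  obtain rfl : (fun i ↦ (maximalIdeal B).toCotangent (w i)) = v := funext hw
  rw [linearIndependent_toCotangent_iff] at hv
  refine (linearIndependent_toCotangent_iff
    (fun i ↦ (⟨algebraMap B B' (w i), algebraMap_base_mem (w i)⟩ : maximalIdeal B'))).mpr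
    fun c hc j ↦ ?_
  obtain ⟨s, hs⟩ := IsLocalization.exist_integer_multiples
    ((maximalIdeal B).map (C : B →+* B[X])).primeCompl Finset.univ c
  choose f hf using fun i ↦ hs i (Finset.mem_univ i)
  have hu : IsUnit (algebraMap B[X] B' s) := IsLocalization.map_units B' s
  have hf' : ∀ i, algebraMap B[X] B' (f i) = algebraMap B[X] B' s * c i := fun i ↦ by
    rw [hf i, Algebra.smul_def]
  have hsum : algebraMap B[X] B' (∑ i, f i * C (w i : B)) ∈ maximalIdeal B' ^ 2 := by
    have : algebraMap B[X] B' (∑ i, f i * C (w i : B)) =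
        algebraMap B[X] B' s * ∑ i, c i * algebraMap B B' (w i) := by
      rw [map_sum, Finset.mul_sum]
      refine Finset.sum_congr rfl fun i _ ↦ ?_
      rw [map_mul, hf', algebraMap_C, mul_assoc]
    rw [this]
    exact Ideal.mul_mem_left _ _ hc
  rw [algebraMap_mem_pow_iff] at hsum
  have hcoeff : ∀ n, (f j).coeff n ∈ maximalIdeal B := fun n ↦
    hv (fun i ↦ (f i).coeff n) (by simpa [finsetSum_coeff] using hsum n) j
  rw [← algebraMap_mem_maximalIdeal_iff, hf'] at hcoeff
  exact (Ideal.unit_mul_mem_iff_mem _ hu).mp hcoeff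

theorem span_cotangentMap_image_top :
    Submodule.span (ResidueField B') (cotangentMap B '' Set.univ) = ⊤ := by
  refine eq_top_iff.mpr fun v' _ ↦ ?_
  obtain ⟨y, rfl⟩ := (maximalIdeal B').toCotangent_surjective v'
  obtain ⟨u, f, hu, hf⟩ := exists_isUnit_mul_eq_algebraMap (y : B')
  exact toCotangent_mem_of_coeff_mem _ y hu hf fun i b _ ↦
    Submodule.subset_span ⟨_, Set.mem_univ _, rfl⟩

/-- One inclusion holds because `ν̄` is preserved on `B`. For the other, if `ν̄ > 1` at an element
of `𝔪'`, then `ν̄ > 1` at every coefficient of its numerator. -/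
theorem span_cotangentMap_image_lambdaKer :
    Submodule.span (ResidueField B') (cotangentMap B '' (lambdaKer B)) = lambdaKer B' := by
  apply le_antisymm
  · rw [Submodule.span_le]
    rintro _ ⟨v, hv, rfl⟩
    obtain ⟨b, rfl⟩ := (maximalIdeal B).toCotangent_surjective v
    rw [cotangentMap_toCotangent]
    refine (toCotangent_mem_lambdaKer_iff _).mpr ?_
    rw [asymptoticSamuel_algebraMap_base]
    exact (toCotangent_mem_lambdaKer_iff b).mp hv
  · intro v' hv'
    obtain ⟨y, rfl⟩ := (maximalIdeal B').toCotangent_surjective v'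
    obtain ⟨u, f, hu, hf⟩ := exists_isUnit_mul_eq_algebraMap (y : B')
    refine toCotangent_mem_of_coeff_mem _ y hu hf fun i b hb ↦
      Submodule.subset_span ⟨_, (toCotangent_mem_lambdaKer_iff b).mpr ?_, rfl⟩
    rw [hb]
    refine lt_of_lt_of_le ((toCotangent_mem_lambdaKer_iff y).mp hv') ?_
    rw [← asymptoticSamuel_mul_of_isUnit _ hu, hf]
    exact asymptoticSamuel_algebraMap_le_coeff f i

theorem IsLambdaSequence.polynomialLocalization {t : ℕ} {γ : Fin t → maximalIdeal B}
    (hγ : IsLambdaSequence γ) :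
    IsLambdaSequence (fun i ↦
      (⟨algebraMap B B' (γ i), algebraMap_base_mem (γ i)⟩ : maximalIdeal B')) := by
  refine ⟨linearIndependent_cotangentMap hγ.1, ?_⟩
  rw [← span_cotangentMap_image_lambdaKer, ← hγ.2, span_cotangentMap_image_span, ← Set.range_comp]
  rfl

/-! ### Invariance of the dimensions. -/

theorem ringKrullDim_polynomialLocalization [IsNoetherianRing B] :
    ringKrullDim B' = ringKrullDim B := by
  rw [IsLocalization.AtPrime.ringKrullDim_eq_height ((maximalIdeal B).map (C : B →+* B[X])) B',
    Polynomial.height_map_C, maximalIdeal_height_eq_ringKrullDim]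

instance [IsNoetherianRing B] : IsNoetherianRing B' :=
  IsLocalization.isNoetherianRing ((maximalIdeal B).map (C : B →+* B[X])).primeCompl _ inferInstance

variable [IsNoetherianRing B]

theorem finrank_span_cotangentMap_image (U : Submodule (ResidueField B) (CotangentSpace B)) :
    Module.finrank (ResidueField B')
      (Submodule.span (ResidueField B') (cotangentMap B '' U)) =
      Module.finrank (ResidueField B) U := by
  let b := Module.finBasis (ResidueField B) U
  have hli : LinearIndependent (ResidueField B) (fun i ↦ (b i : CotangentSpace B)) :=
    b.linearIndependent.map' U.subtype U.ker_subtype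
  have hspan : Submodule.span (ResidueField B) (Set.range fun i ↦ (b i : CotangentSpace B)) = U := by
    have := congrArg (Submodule.map U.subtype) b.span_eq
    rwa [Submodule.map_span, ← Set.range_comp, Submodule.map_top, Submodule.range_subtype] at this
  have h := finrank_span_eq_card (linearIndependent_cotangentMap hli)
  rw [Fintype.card_fin] at h
  conv_lhs => rw [← hspan, span_cotangentMap_image_span, ← Set.range_comp]
  exact h

theorem finrank_cotangentSpace_polynomialLocalization :
    Module.finrank (ResidueField B') (CotangentSpace B') =
      Module.finrank (ResidueField B) (CotangentSpace B) := by
  have h := finrank_span_cotangentMap_image (⊤ : Submodule (ResidueField B) (CotangentSpace B))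
  rwa [Submodule.top_coe, span_cotangentMap_image_top, finrank_top, finrank_top] at h

theorem finrank_lambdaKer_polynomialLocalization :
    Module.finrank (ResidueField B') (lambdaKer B') =
      Module.finrank (ResidueField B) (lambdaKer B) := by
  rw [← span_cotangentMap_image_lambdaKer, finrank_span_cotangentMap_image]

theorem excEmbDim_polynomialLocalization : excEmbDim B' = excEmbDim B := by
  rw [excEmbDim, excEmbDim, finrank_cotangentSpace_polynomialLocalization,
    ringKrullDim_polynomialLocalization]

/-- From a `λ`-sequence of `B'` one obtains one of `B`, of at least the same slope, among the
coefficients of its numerators. -/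
theorem IsLambdaSequence.exists_of_polynomialLocalization {t : ℕ} {γ' : Fin t → maximalIdeal B'}
    (hγ' : IsLambdaSequence γ') :
    ∃ γ : Fin t → maximalIdeal B, IsLambdaSequence γ ∧
      ∀ i, ⨅ j, asymptoticSamuel (maximalIdeal B') (γ' j : B') ≤
        asymptoticSamuel (maximalIdeal B) (γ i : B) := by
  set r := ⨅ j, asymptoticSamuel (maximalIdeal B') (γ' j : B')
  -- The bound `1 <` already follows from the bound by `r`, a minimum of finitely many values `> 1`
  -- (or `⊤` if `t = 0`); including it spares that argument.
  let S : Set (CotangentSpace B) := (maximalIdeal B).toCotangent ''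
    {b | r ≤ asymptoticSamuel (maximalIdeal B) (b : B) ∧
      1 < asymptoticSamuel (maximalIdeal B) (b : B)}
  have hle : Submodule.span (ResidueField B) S ≤ lambdaKer B := by
    rw [Submodule.span_le]
    rintro _ ⟨b, hb, rfl⟩
    exact (toCotangent_mem_lambdaKer_iff b).mpr hb.2
  have hle' : lambdaKer B' ≤ Submodule.span (ResidueField B') (cotangentMap B '' S) := by
    rw [← hγ'.2, Submodule.span_le]
    rintro _ ⟨j, rfl⟩
    obtain ⟨u, f, hu, hf⟩ := exists_isUnit_mul_eq_algebraMap (γ' j : B')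
    refine toCotangent_mem_of_coeff_mem _ (γ' j) hu hf fun i b hb ↦
      Submodule.subset_span ⟨_, ⟨b, ?_, rfl⟩, rfl⟩
    have h1 : asymptoticSamuel (maximalIdeal B') (γ' j : B') ≤
        asymptoticSamuel (maximalIdeal B) (b : B) := by
      rw [hb, ← asymptoticSamuel_mul_of_isUnit _ hu, hf]
      exact asymptoticSamuel_algebraMap_le_coeff f i
    refine ⟨(iInf_le _ j).trans h1, lt_of_lt_of_le ?_ h1⟩
    rw [← toCotangent_mem_lambdaKer_iff, ← hγ'.2]
    exact Submodule.subset_span ⟨j, rfl⟩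
  -- Equality is forced by dimension: the extension of the span of `S` contains `ker λ_{𝔪'}`, and
  -- extension preserves dimensions.
  have hspan : Submodule.span (ResidueField B) S = lambdaKer B := by
    refine Submodule.eq_of_le_of_finrank_le hle ?_
    rw [← finrank_lambdaKer_polynomialLocalization (B := B),
      ← finrank_span_cotangentMap_image (B := B), span_cotangentMap_image_span]
    exact Submodule.finrank_mono hle'
  have hcard : Module.finrank (ResidueField B) (Submodule.span (ResidueField B) S) = t := by
    rw [hspan, ← finrank_lambdaKer_polynomialLocalization (B := B), ← hγ'.2, finrank_span_eq_card hγ'.1,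
      Fintype.card_fin]
  -- The basis is taken from `S` itself, not merely from its span, so that its members lift to
  -- elements with `ν̄ ≥ r`.
  have hg := Submodule.exists_fun_fin_finrank_span_eq (ResidueField B) S
  rw [hcard] at hg
  obtain ⟨g, hgS, hgspan, hgli⟩ := hg
  choose γ hγ hγg using hgS
  obtain rfl : (fun i ↦ (maximalIdeal B).toCotangent (γ i)) = g := funext hγg
  exact ⟨γ, ⟨hgli, hgspan.trans hspan⟩, fun i ↦ (hγ i).1⟩

/-! ### Equality of the slopes. -/

theorem iSup_isLambdaSequence_polynomialLocalization (t : ℕ) :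
    ⨆ (γ : Fin t → maximalIdeal B) (_ : IsLambdaSequence γ),
      ⨅ i, asymptoticSamuel (maximalIdeal B) (γ i : B) =
    ⨆ (γ : Fin t → maximalIdeal B') (_ : IsLambdaSequence γ),
      ⨅ i, asymptoticSamuel (maximalIdeal B') (γ i : B') := by
  apply le_antisymm
  · refine iSup₂_le fun γ hγ ↦ le_iSup₂_of_le _ hγ.polynomialLocalization (le_of_eq ?_)
    simp only [asymptoticSamuel_algebraMap_base]
  · refine iSup₂_le fun γ' hγ' ↦ ?_
    obtain ⟨γ, hγ, h⟩ := hγ'.exists_of_polynomialLocalization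
    exact le_iSup₂_of_le γ hγ (le_iInf h)

theorem samuelSlope_polynomialLocalization : samuelSlope B = samuelSlope B' := by
  have hreg : IsRegularLocalRing B' ↔ IsRegularLocalRing B := by
    rw [isRegularLocalRing_iff_excEmbDim_eq_zero, isRegularLocalRing_iff_excEmbDim_eq_zero,
      excEmbDim_polynomialLocalization]
  have hext : IsExtremal B' ↔ IsExtremal B := by
    rw [IsExtremal, IsExtremal, finrank_lambdaKer_polynomialLocalization,
      excEmbDim_polynomialLocalization]
  rw [samuelSlope, samuelSlope, excEmbDim_polynomialLocalization,
    iSup_isLambdaSequence_polynomialLocalization]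
  rw [propext hreg, propext hext]

end Polynomial

end SamuelSlope

theorem proposition5p1 {B : Type*} [CommRing B] [IsLocalRing B] [IsNoetherianRing B] :
    IsLocalRing.maximalIdeal (SamuelSlope.PolynomialLocalization B) =
        (IsLocalRing.maximalIdeal B).map
          (algebraMap B (SamuelSlope.PolynomialLocalization B)) ∧
      SamuelSlope.samuelSlope B =
        SamuelSlope.samuelSlope (SamuelSlope.PolynomialLocalization B) :=
  ⟨SamuelSlope.maximalIdeal_polynomialLocalization, SamuelSlope.samuelSlope_polynomialLocalization⟩
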